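/- Let $n\ge 1$. An $n$-dimensional lattice is a set $L=\{\sum_{i=1}^n a_i b_i : a_i\in\mathbb Z\}\subset\mathbb R^n$ with $b_1,\dots,b_n\in\mathbb R^n$ linearly independent. For $1\le i\le n$ its $i$-th successive minimum is $$\lambda_i(L)=\inf\{r>0 : \dim \operatorname{span}\{x\in L:\|x\|\le r\}\ge i\},$$ where $\|\cdot\|$ is the Euclidean norm. For two $n$-dimensional lattices $L_1,L_2$ put $$M(L_1,L_2)=\max_{1\le i\le n}\frac{\lambda_i(L_2)}{\lambda_i(L_1)},\qquad \operatorname{dist}(L_1,L_2)=\min\{\|T\|\,\|T^{-1}\| : T:\mathbb R^n\to\mathbb R^n \text{ linear and bijective},\ T(L_1)=L_2\},$$ with $\|T\|=\sup_{\|x\|=1}\|Tx\|$ the operator norm. Theorem. There is an absolute constant $C>0$ such that for every $n\ge 1$ and all $n$-dimensional lattices $L_1,L_2\subset\mathbb R^n$, $$M(L_1,L_2)\,M(L_2,L_1)\ \le\ \operatorname{dist}(L_1,L_2)\ \le\ n^{C\log n}\,M(L_1,L_2)\,M(L_2,L_1).$$ -/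

import Mathlib

open Module

noncomputable section

/-- The `i`-th successive minimum of a lattice `L` in `ℝⁿ`: the infimum of all radii `r > 0` such
that the lattice vectors of Euclidean norm at most `r` span a subspace of dimension at least `i`. -/
def successiveMin {n : ℕ} (L : Submodule ℤ (EuclideanSpace ℝ (Fin n))) (i : ℕ) : ℝ :=
  sInf {r : ℝ | 0 < r ∧
    i ≤ finrank ℝ (Submodule.span ℝ ((L : Set (EuclideanSpace ℝ (Fin n))) ∩ Metric.closedBall 0 r))}

/-- `M(L₁, L₂) = max_{1 ≤ i ≤ n} λᵢ(L₂) / λᵢ(L₁)`. The index set `Fin n` is finite, so for `n ≥ 1`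
the supremum is a maximum. -/
def minimaRatio {n : ℕ} (L₁ L₂ : Submodule ℤ (EuclideanSpace ℝ (Fin n))) : ℝ :=
  ⨆ i : Fin n, successiveMin L₂ ((i : ℕ) + 1) / successiveMin L₁ ((i : ℕ) + 1)

/-- The condition number `κ(T) = ‖T‖ ‖T⁻¹‖` with respect to the Euclidean operator norm. -/
def condNumber {n : ℕ} (T : EuclideanSpace ℝ (Fin n) ≃L[ℝ] EuclideanSpace ℝ (Fin n)) : ℝ :=
  ‖(T : EuclideanSpace ℝ (Fin n) →L[ℝ] EuclideanSpace ℝ (Fin n))‖ *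
    ‖(T.symm : EuclideanSpace ℝ (Fin n) →L[ℝ] EuclideanSpace ℝ (Fin n))‖

/-- The condition numbers of all linear bijections `T` of `ℝⁿ` with `T(L₁) = L₂`. -/
def condNumbers {n : ℕ} (L₁ L₂ : Submodule ℤ (EuclideanSpace ℝ (Fin n))) : Set ℝ :=
  {κ : ℝ | ∃ T : EuclideanSpace ℝ (Fin n) ≃L[ℝ] EuclideanSpace ℝ (Fin n),
    T '' (L₁ : Set (EuclideanSpace ℝ (Fin n))) = L₂ ∧ condNumber T = κ}

/-- The distortion `dist(L₁, L₂) = min {‖T‖ ‖T⁻¹‖ : T(L₁) = L₂}`; see `latticeDist_isLeast` for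
the fact that the infimum is a minimum. -/
def latticeDist {n : ℕ} (L₁ L₂ : Submodule ℤ (EuclideanSpace ℝ (Fin n))) : ℝ :=
  sInf (condNumbers L₁ L₂)

theorem exists_zlattice_basis {n : ℕ} (L : Submodule ℤ (EuclideanSpace ℝ (Fin n)))
    [DiscreteTopology L] [IsZLattice ℝ L] :
    ∃ b : Basis (Fin n) ℝ (EuclideanSpace ℝ (Fin n)), Submodule.span ℤ (Set.range b) = L := by
  have := ZLattice.module_finite ℝ L
  have := ZLattice.module_free ℝ L
  have h : finrank ℤ L = n := by rw [ZLattice.rank ℝ L]; simp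
  exact ⟨(finBasisOfFinrankEq ℤ L h).ofZLatticeBasis ℝ L, Basis.ofZLatticeBasis_span (L := L) ℝ _⟩

theorem condNumbers_nonempty {n : ℕ} (L₁ L₂ : Submodule ℤ (EuclideanSpace ℝ (Fin n)))
    [DiscreteTopology L₁] [IsZLattice ℝ L₁] [DiscreteTopology L₂] [IsZLattice ℝ L₂] :
    (condNumbers L₁ L₂).Nonempty := by
  obtain ⟨b, hb⟩ := exists_zlattice_basis L₁
  obtain ⟨c, hc⟩ := exists_zlattice_basis L₂
  refine ⟨_, (b.equiv c (Equiv.refl _)).toContinuousLinearEquiv, ?_, rfl⟩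
  have key : L₁.map ((b.equiv c (Equiv.refl _)).toLinearMap.restrictScalars ℤ) = L₂ := by
    rw [← hb, ← hc, Submodule.map_span, ← Set.range_comp]
    congr 2
    ext1 i
    simp
  rw [← key]
  rfl

theorem latticeDist_isLeast {n : ℕ} (L₁ L₂ : Submodule ℤ (EuclideanSpace ℝ (Fin n)))
    [DiscreteTopology L₁] [IsZLattice ℝ L₁] [DiscreteTopology L₂] [IsZLattice ℝ L₂] :
    IsLeast (condNumbers L₁ L₂) (latticeDist L₁ L₂) := by
  suffices h : ∃ κ, IsLeast (condNumbers L₁ L₂) κ by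
    obtain ⟨κ, hκ⟩ := h
    rw [latticeDist, hκ.csInf_eq]
    exact hκ
  obtain ⟨κ₀, T₀, hT₀, hκ₀⟩ := condNumbers_nonempty L₁ L₂
  obtain ⟨b, hb⟩ := exists_zlattice_basis L₁
  obtain ⟨c, hc⟩ := exists_zlattice_basis L₂
  have hbm : ∀ i, b i ∈ L₁ := fun i ↦ hb ▸ Submodule.subset_span ⟨i, rfl⟩
  have hcm : ∀ i, c i ∈ L₂ := fun i ↦ hc ▸ Submodule.subset_span ⟨i, rfl⟩
  have hdisc : ∃ δ > 0, ∀ w ∈ L₁, w ≠ 0 → δ ≤ ‖w‖ := by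
    obtain ⟨δ, hδ, h⟩ := Metric.exists_ball_inter_eq_singleton_of_mem_discrete
      (s := (L₁ : Set (EuclideanSpace ℝ (Fin n)))) DiscreteTopology.isDiscrete (zero_mem L₁)
    refine ⟨δ, hδ, fun w hw hw0 ↦ ?_⟩
    by_contra hlt
    have : w ∈ Metric.ball 0 δ ∩ (L₁ : Set (EuclideanSpace ℝ (Fin n))) :=
      ⟨by simpa using hlt, hw⟩
    rw [h] at this
    exact hw0 this
  obtain ⟨δ, hδ, hδL⟩ := hdisc
  -- every admissible map with condition number at most `κ₀` moves basis vectors boundedly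
  have hbound : ∃ R : ℝ, ∀ T : EuclideanSpace ℝ (Fin n) ≃L[ℝ] EuclideanSpace ℝ (Fin n),
      T '' (L₁ : Set (EuclideanSpace ℝ (Fin n))) = L₂ → condNumber T ≤ κ₀ →
      ∀ i, ‖T (b i)‖ ≤ R := by
    refine ⟨∑ j, κ₀ * ‖c j‖ / δ * ‖b j‖, fun T hT hκ i ↦ ?_⟩
    have hκ0 : 0 ≤ κ₀ := le_trans (by unfold condNumber; positivity) hκ
    refine le_trans ?_ (Finset.single_le_sum (f := fun j ↦ κ₀ * ‖c j‖ / δ * ‖b j‖)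
      (fun j _ ↦ by positivity) (Finset.mem_univ i))
    have h1 : T.symm (c i) ∈ L₁ := by
      have := hcm i
      rw [← SetLike.mem_coe, ← hT] at this
      obtain ⟨w, hw, hwc⟩ := this
      rw [← hwc, T.symm_apply_apply]
      exact hw
    have h2 : δ ≤ ‖T.symm (c i)‖ := hδL _ h1 (by simpa using c.ne_zero i)
    have h3 := (T.symm : EuclideanSpace ℝ (Fin n) →L[ℝ] EuclideanSpace ℝ (Fin n)).le_opNorm (c i)
    have h4 := (T : EuclideanSpace ℝ (Fin n) →L[ℝ] EuclideanSpace ℝ (Fin n)).le_opNorm (b i)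
    refine h4.trans (mul_le_mul_of_nonneg_right ?_ (norm_nonneg _))
    rw [le_div_iff₀ hδ]
    calc _ ≤ ‖(T : EuclideanSpace ℝ (Fin n) →L[ℝ] EuclideanSpace ℝ (Fin n))‖ *
          (‖(T.symm : EuclideanSpace ℝ (Fin n) →L[ℝ] EuclideanSpace ℝ (Fin n))‖ * ‖c i‖) :=
          mul_le_mul_of_nonneg_left (h2.trans h3) (norm_nonneg _)
      _ = condNumber T * ‖c i‖ := by rw [condNumber, mul_assoc]
      _ ≤ κ₀ * ‖c i‖ := mul_le_mul_of_nonneg_right hκ (norm_nonneg _)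
  obtain ⟨R, hR⟩ := hbound
  have hfin : {T : EuclideanSpace ℝ (Fin n) ≃L[ℝ] EuclideanSpace ℝ (Fin n) |
      T '' (L₁ : Set (EuclideanSpace ℝ (Fin n))) = L₂ ∧ condNumber T ≤ κ₀}.Finite := by
    have hB : (Metric.closedBall (0 : EuclideanSpace ℝ (Fin n)) R ∩
        (L₂ : Set (EuclideanSpace ℝ (Fin n)))).Finite :=
      Metric.finite_isBounded_inter_isClosed DiscreteTopology.isDiscrete
        Metric.isBounded_closedBall
        (@AddSubgroup.isClosed_of_discrete _ _ _ _ _ L₂.toAddSubgroup ‹_›)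
    refine Set.Finite.of_finite_image (f := fun T i ↦ T (b i))
      ((Set.Finite.pi' (fun _ : Fin n ↦ hB)).subset ?_) ?_
    · rintro _ ⟨T, ⟨hT, hκ⟩, rfl⟩ i
      refine ⟨by simpa using hR T hT hκ i, ?_⟩
      rw [← hT]
      exact ⟨_, hbm i, rfl⟩
    · intro T _ T' _ h
      apply ContinuousLinearEquiv.toLinearEquiv_injective
      exact b.ext' fun i ↦ congrFun h i
  obtain ⟨T, ⟨hT, hκ⟩, hmin⟩ := Set.exists_min_image _ condNumber hfin ⟨T₀, hT₀, hκ₀.le⟩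
  refine ⟨condNumber T, ⟨T, hT, rfl⟩, ?_⟩
  rintro _ ⟨T', hT', rfl⟩
  rcases le_total (condNumber T') κ₀ with h | h
  · exact hmin T' ⟨hT', h⟩
  · exact hκ.trans h

end

/-!
# Lattice distortion and successive minima

The lower bound holds because a linear map `T` with `T(L₁) = L₂` multiplies each successive minimum
by at most `‖T‖`, and its inverse by at most `‖T⁻¹‖` (`minimaRatio_le_norm`).

For the upper bound it is enough that every lattice has a basis `b` such that, up to a factor
`n ^ O(log n)`, the vector `b i` has length `λᵢ` and the `i`-th coordinate functional has norm
`1 / λᵢ`: the linear map carrying such a basis of `L₁` to one of `L₂` then has norm at most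
`n ^ O(log n) * M(L₁, L₂)`, and the same holds for its inverse (`IsGraded.norm_equiv_le`).

Such a basis is found in two steps. A Hermite–Korkine–Zolotarev basis is chosen greedily, each
vector having the shortest nonzero projection orthogonal to its predecessors (`exists_isHKZ`). Its
`i`-th Gram–Schmidt length `a i` is at most `λᵢ` since any `i` independent vectors include one with
nonzero projection. Minkowski's theorem in the blocks of the projected lattices
(`IsHKZ.pow_le_prod`) and a summation of the resulting logarithmic inequalities
(`le_of_mul_le_mul_log_add_sum`) give `a j ≤ n ^ O(log n) * a i` for `j ≤ i`
(`IsHKZ.inner_le_exp_mul`). The unitriangular matrix of Gram–Schmidt coefficients is then replaced,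
by integral column operations, with one that has entries of size `n ^ O(log n)` together with its
inverse (`exists_seysen_reduction`). The new basis `b` and its dual are controlled by the `a i`
alone (`exists_isGraded`), and the first `i` vectors of `b` show `λᵢ ≤ n ^ O(log n) * a i`.
-/

/-! ### Seysen's reduction of unitriangular matrices -/

/-- Upper unitriangular square matrices: zero below the diagonal, ones on it. -/
def Matrix.IsUnitriangular {ι R : Type*} [LT ι] [Zero R] [One R] (M : Matrix ι ι R) : Prop :=
  (∀ i, M i i = 1) ∧ M.BlockTriangular id

theorem Matrix.IsUnitriangular.reindex_fromBlocks {R : Type*} [Zero R] [One R] {p q : ℕ}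
    {A : Matrix (Fin p) (Fin p) R} {D : Matrix (Fin q) (Fin q) R}
    (hA : A.IsUnitriangular) (hD : D.IsUnitriangular) (B : Matrix (Fin p) (Fin q) R) :
    (Matrix.reindex finSumFinEquiv finSumFinEquiv (Matrix.fromBlocks A B 0 D)).IsUnitriangular := by
  refine ⟨fun i ↦ ?_, fun i j hij ↦ ?_⟩
  · induction i using Fin.addCases with
    | left i => simpa using hA.1 i
    | right i => simpa using hD.1 i
  · simp only [id] at hij
    induction i using Fin.addCases with
    | left i =>
      induction j using Fin.addCases with
      | left j => simpa using hA.2 (show j < i from hij)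
      | right j => simp [Fin.lt_def] at hij; omega
    | right i =>
      induction j using Fin.addCases with
      | left j => simp
      | right j => simpa using hD.2 (by simpa using hij : j < i)

theorem Matrix.IsUnitriangular.exists_reindex_fromBlocks {R : Type*} [Zero R] [One R] {p q : ℕ}
    {U : Matrix (Fin (p + q)) (Fin (p + q)) R} (hU : U.IsUnitriangular) :
    ∃ (A : Matrix (Fin p) (Fin p) R) (B : Matrix (Fin p) (Fin q) R) (D : Matrix (Fin q) (Fin q) R),
      A.IsUnitriangular ∧ D.IsUnitriangular ∧
        U = Matrix.reindex finSumFinEquiv finSumFinEquiv (Matrix.fromBlocks A B 0 D) := by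
  refine ⟨U.submatrix (Fin.castAdd q) (Fin.castAdd q), U.submatrix (Fin.castAdd q) (Fin.natAdd p),
    U.submatrix (Fin.natAdd p) (Fin.natAdd p), ⟨fun i ↦ hU.1 _, fun i j hij ↦ hU.2 ?_⟩,
    ⟨fun i ↦ hU.1 _, fun i j hij ↦ hU.2 ?_⟩, ?_⟩
  · exact (show Fin.castAdd q j < Fin.castAdd q i from hij)
  · exact (Fin.natAdd_lt_natAdd_iff p).2 hij
  · ext i j
    induction i using Fin.addCases with
    | left i => induction j using Fin.addCases <;> simp
    | right i =>
      induction j using Fin.addCases with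
      | left j =>
        have : U (Fin.natAdd p i) (Fin.castAdd q j) = 0 :=
          hU.2 (by simp [Fin.lt_def]; omega)
        simpa using this
      | right j => simp

theorem abs_reindex_fromBlocks_le {p q : ℕ} {A : Matrix (Fin p) (Fin p) ℝ}
    {B : Matrix (Fin p) (Fin q) ℝ} {D : Matrix (Fin q) (Fin q) ℝ} {c : ℝ}
    (hA : ∀ i j, |A i j| ≤ c) (hB : ∀ i j, |B i j| ≤ c) (hD : ∀ i j, |D i j| ≤ c) (hc : 0 ≤ c)
    (i j : Fin (p + q)) :
    |Matrix.reindex finSumFinEquiv finSumFinEquiv (Matrix.fromBlocks A B 0 D) i j| ≤ c := by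
  induction i using Fin.addCases <;> induction j using Fin.addCases <;> simp_all

theorem abs_matrix_mul_apply_le {l m n : Type*} [Fintype m] {A : Matrix l m ℝ} {B : Matrix m n ℝ}
    {a b : ℝ} (hA : ∀ i j, |A i j| ≤ a) (hB : ∀ i j, |B i j| ≤ b) (i : l) (j : n) :
    |(A * B) i j| ≤ Fintype.card m * (a * b) := by
  rw [Matrix.mul_apply]
  refine (Finset.abs_sum_le_sum_abs _ _).trans ((Finset.sum_le_card_nsmul _ _ (a * b) ?_).trans ?_)
  · intro x _
    rw [abs_mul]
    have := (abs_nonneg (A i x)).trans (hA i x)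
    exact mul_le_mul (hA i x) (hB x j) (abs_nonneg _) this
  · simp

/-- Seysen's reduction: the columns of a real unitriangular matrix can be combined by an integral
unitriangular `V` so that the product `P` and its inverse `Q` both have small entries. Splitting the
matrix into halves and reducing the diagonal blocks first, the off-diagonal block of `P` can be
brought to the form `P₁ * R` with `R` reduced modulo `1`; the off-diagonal block of `Q` is then
`-(R * Q₂)`, so each doubling of the size costs only a factor of the size. -/
theorem exists_seysen_reduction (k : ℕ) : ∀ (n : ℕ), n ≤ 2 ^ k → ∀ U : Matrix (Fin n) (Fin n) ℝ,
    U.IsUnitriangular → ∃ (V : Matrix (Fin n) (Fin n) ℤ) (P Q : Matrix (Fin n) (Fin n) ℝ),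
      V.IsUnitriangular ∧ P.IsUnitriangular ∧ Q.IsUnitriangular ∧
      U * V.map (Int.cast : ℤ → ℝ) = P ∧ P * Q = 1 ∧
      (∀ i j, |P i j| ≤ 2 ^ k ^ 2) ∧ (∀ i j, |Q i j| ≤ 2 ^ k ^ 2) := by
  induction k with
  | zero =>
    intro n hn U hU
    have : Subsingleton (Fin n) := Fin.subsingleton_iff_le_one.2 (by simpa using hn)
    have hU1 : U = 1 := by
      ext i j
      obtain rfl := Subsingleton.elim i j
      simp [hU.1]
    have h1 : ∀ i j, |(1 : Matrix (Fin n) (Fin n) ℝ) i j| ≤ 2 ^ 0 ^ 2 := fun i j ↦ by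
      rw [Subsingleton.elim i j]; simp
    subst hU1
    exact ⟨1, 1, 1, ⟨fun i ↦ by simp, Matrix.blockTriangular_one⟩, hU, hU,
      by simp [Matrix.map_one], by simp, h1, h1⟩
  | succ k ih =>
    intro n hn U hU
    obtain ⟨p, q, hp, hq, rfl⟩ : ∃ p q, p ≤ 2 ^ k ∧ q ≤ 2 ^ k ∧ n = p + q :=
      ⟨n / 2, n - n / 2, by rw [pow_succ] at hn; omega, by rw [pow_succ] at hn; omega, by omega⟩
    obtain ⟨U₁, X, U₂, hU₁, hU₂, rfl⟩ := hU.exists_reindex_fromBlocks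
    obtain ⟨V₁, P₁, Q₁, hV₁, hP₁, hQ₁, hUV₁, hPQ₁, hbP₁, hbQ₁⟩ := ih p hp U₁ hU₁
    obtain ⟨V₂, P₂, Q₂, hV₂, hP₂, hQ₂, hUV₂, hPQ₂, hbP₂, hbQ₂⟩ := ih q hq U₂ hU₂
    set Y : Matrix (Fin p) (Fin q) ℝ := Q₁ * (X * V₂.map (Int.cast : ℤ → ℝ)) with hY
    set W : Matrix (Fin p) (Fin q) ℤ := Matrix.of fun i j ↦ -round (Y i j) with hW
    set R : Matrix (Fin p) (Fin q) ℝ := Y + W.map (Int.cast : ℤ → ℝ) with hR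
    have hRb : ∀ i j, |R i j| ≤ 1 := fun i j ↦ by
      have := abs_sub_round (Y i j)
      have h : R i j = Y i j - round (Y i j) := by simp [hR, hW, sub_eq_add_neg]
      rw [h]; linarith
    have hPY : P₁ * Y = X * V₂.map (Int.cast : ℤ → ℝ) := by
      rw [hY, ← Matrix.mul_assoc, hPQ₁, Matrix.one_mul]
    have hexp : (2 : ℝ) ^ k * 2 ^ k ^ 2 ≤ 2 ^ (k + 1) ^ 2 := by
      rw [← pow_add]
      exact pow_le_pow_right₀ (by norm_num) (by nlinarith)
    have hmono : (2 : ℝ) ^ k ^ 2 ≤ 2 ^ (k + 1) ^ 2 :=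
      pow_le_pow_right₀ (by norm_num) (Nat.pow_le_pow_left k.le_succ 2)
    have hp' : (p : ℝ) ≤ 2 ^ k := by exact_mod_cast hp
    have hq' : (q : ℝ) ≤ 2 ^ k := by exact_mod_cast hq
    have hbPR : ∀ i j, |(P₁ * R) i j| ≤ 2 ^ (k + 1) ^ 2 := fun i j ↦ by
      refine (abs_matrix_mul_apply_le hbP₁ hRb i j).trans (le_trans ?_ hexp)
      rw [Fintype.card_fin, mul_one]
      gcongr
    have hbRQ : ∀ i j, |(-(R * Q₂)) i j| ≤ 2 ^ (k + 1) ^ 2 := fun i j ↦ by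
      rw [Matrix.neg_apply, abs_neg]
      refine (abs_matrix_mul_apply_le hRb hbQ₂ i j).trans (le_trans ?_ hexp)
      rw [Fintype.card_fin, one_mul]
      gcongr
    refine ⟨_, _, _, hV₁.reindex_fromBlocks hV₂ (V₁ * W), hP₁.reindex_fromBlocks hP₂ (P₁ * R),
      hQ₁.reindex_fromBlocks hQ₂ (-(R * Q₂)), ?_, ?_, ?_, ?_⟩
    · rw [Matrix.reindex_apply, Matrix.reindex_apply, Matrix.reindex_apply, ← Matrix.submatrix_map,
        Matrix.submatrix_mul_equiv, Matrix.fromBlocks_map, Matrix.fromBlocks_multiply]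
      have h0 : (0 : Matrix (Fin q) (Fin p) ℤ).map (Int.cast : ℤ → ℝ) = 0 := by ext; simp
      have hVW : (V₁ * W).map (Int.cast : ℤ → ℝ) =
          V₁.map (Int.cast : ℤ → ℝ) * W.map (Int.cast : ℤ → ℝ) :=
        Matrix.map_mul (f := Int.castRingHom ℝ)
      rw [h0, hVW, ← Matrix.mul_assoc, hUV₁, hUV₂, ← hPY, ← Matrix.mul_add, add_comm _ Y]
      simp [hR]
    · rw [Matrix.reindex_apply, Matrix.reindex_apply, Matrix.submatrix_mul_equiv,
        Matrix.fromBlocks_multiply, hPQ₁, hPQ₂]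
      simp [Matrix.mul_assoc]
    · exact abs_reindex_fromBlocks_le (fun i j ↦ (hbP₁ i j).trans hmono) hbPR
        (fun i j ↦ (hbP₂ i j).trans hmono) (by positivity)
    · exact abs_reindex_fromBlocks_le (fun i j ↦ (hbQ₁ i j).trans hmono) hbRQ
        (fun i j ↦ (hbQ₂ i j).trans hmono) (by positivity)

/-! ### Minkowski's theorem on linear forms -/

/-- Minkowski's theorem on linear forms. It is the convex body theorem for the cube of side `2 * t`
and the lattice generated by the columns of `A`. -/
theorem Matrix.exists_int_ne_zero_abs_mulVec_le {ι : Type*} [Fintype ι] [DecidableEq ι] [Nonempty ι]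
    (A : Matrix ι ι ℝ) (hA : A.det ≠ 0) {t : ℝ} (ht : |A.det| ≤ t ^ Fintype.card ι)
    (ht0 : 0 ≤ t) :
    ∃ z : ι → ℤ, z ≠ 0 ∧ ∀ i, |∑ j, A i j * z j| ≤ t := by
  let b : Basis ι ℝ (ι → ℝ) := basisOfLinearIndependentOfCardEqFinrank
    (Matrix.linearIndependent_cols_of_det_ne_zero hA) (by simp)
  have hb : ∀ j i, b j i = A i j := fun j i ↦ by
    simp only [b, coe_basisOfLinearIndependentOfCardEqFinrank]
    rfl
  have hdet : (Matrix.of b).det = A.det := by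
    rw [← Matrix.det_transpose A]
    congr 1
    ext i j
    simp [hb]
  have : Countable (Submodule.span ℤ (Set.range b)).toAddSubgroup :=
    inferInstanceAs (Countable (Submodule.span ℤ (Set.range b)))
  have : DiscreteTopology (Submodule.span ℤ (Set.range b)).toAddSubgroup :=
    inferInstanceAs (DiscreteTopology (Submodule.span ℤ (Set.range b)))
  obtain ⟨x, hx0, hx⟩ :=
    MeasureTheory.exists_ne_zero_mem_lattice_of_measure_mul_two_pow_le_measure
      (L := (Submodule.span ℤ (Set.range b)).toAddSubgroup) (s := Metric.closedBall (0 : ι → ℝ) t)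
      (ZSpan.isAddFundamentalDomain b MeasureTheory.volume)
      (by simp) (convex_closedBall _ _) (isCompact_closedBall _ _) (by
        rw [ZSpan.volume_fundamentalDomain, hdet, Real.volume_pi_closedBall _ ht0,
          show (2 : ENNReal) = ENNReal.ofReal 2 by simp, ← ENNReal.ofReal_pow (by norm_num),
          ← ENNReal.ofReal_mul (abs_nonneg _)]
        apply ENNReal.ofReal_le_ofReal
        rw [Module.finrank_pi, mul_pow, mul_comm]
        gcongr)
  obtain ⟨z, hz⟩ := (Submodule.mem_span_range_iff_exists_fun ℤ).1 x.2
  refine ⟨z, ?_, fun i ↦ ?_⟩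
  · rintro rfl
    apply hx0
    ext1
    rw [← hz]
    simp
  · have h1 : |(x : ι → ℝ) i| ≤ t := by
      have := norm_le_pi_norm (x : ι → ℝ) i
      exact this.trans (by simpa using hx)
    rw [← hz] at h1
    simpa [hb, mul_comm] using h1

/-! ### Shortest projections in a lattice -/

section
variable {E : Type*} [NormedAddCommGroup E] [InnerProductSpace ℝ E] [FiniteDimensional ℝ E]

theorem Submodule.starProjection_orthogonal_eq_zero_iff (W : Submodule ℝ E) (x : E) :
    Wᗮ.starProjection x = 0 ↔ x ∈ W := by
  rw [Submodule.starProjection_apply_eq_zero_iff, Submodule.orthogonal_orthogonal]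

theorem finite_lattice_inter_closedBall (L : Submodule ℤ E) [DiscreteTopology L] (r : ℝ) :
    ((L : Set E) ∩ Metric.closedBall 0 r).Finite := by
  rw [Set.inter_comm]
  exact Metric.finite_isBounded_inter_isClosed DiscreteTopology.isDiscrete
    Metric.isBounded_closedBall (@AddSubgroup.isClosed_of_discrete _ _ _ _ _ L.toAddSubgroup ‹_›)

/-- Among the vectors of a discrete lattice outside the span `W` of finitely many lattice vectors,
one has the shortest projection to `Wᗮ`. Modulo the given vectors only finitely many candidates
have to be compared, although the projected lattice is not known here to be discrete. -/
theorem exists_minimal_projection (L : Submodule ℤ E) [DiscreteTopology L] {k : ℕ} {v : Fin k → E}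
    (hvL : ∀ i, v i ∈ L) {y : E} (hyL : y ∈ L) (hy : y ∉ Submodule.span ℝ (Set.range v)) :
    ∃ x ∈ L, x ∉ Submodule.span ℝ (Set.range v) ∧
      ∀ z ∈ L, z ∉ Submodule.span ℝ (Set.range v) →
        ‖(Submodule.span ℝ (Set.range v))ᗮ.starProjection x‖ ≤
          ‖(Submodule.span ℝ (Set.range v))ᗮ.starProjection z‖ := by
  set W := Submodule.span ℝ (Set.range v) with hW
  set r := ‖Wᗮ.starProjection y‖ with hr
  -- subtracting a suitable lattice vector of `W` shortens a vector without changing its projection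
  have hshort : ∀ z ∈ L, z ∉ W → ‖Wᗮ.starProjection z‖ ≤ r → ∃ z' ∈ L, z' ∉ W ∧
      ‖z'‖ ≤ r + ∑ i, ‖v i‖ ∧ Wᗮ.starProjection z' = Wᗮ.starProjection z := by
    intro z hzL hz hzr
    obtain ⟨c, hc⟩ := (Submodule.mem_span_range_iff_exists_fun ℝ).1 (W.starProjection_apply_mem z)
    have hwW : ∑ i, ⌊c i⌋ • v i ∈ W := by
      refine sum_mem fun i _ ↦ ?_
      rw [← Int.cast_smul_eq_zsmul ℝ]
      exact W.smul_mem _ (Submodule.subset_span ⟨i, rfl⟩)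
    refine ⟨z - ∑ i, ⌊c i⌋ • v i, sub_mem hzL (sum_mem fun i _ ↦ L.smul_mem _ (hvL i)),
      fun h ↦ hz (by simpa using add_mem h hwW), ?_, ?_⟩
    · have h1 : z - ∑ i, ⌊c i⌋ • v i = Wᗮ.starProjection z + ∑ i, Int.fract (c i) • v i := by
        rw [Submodule.starProjection_orthogonal_val, ← hc]
        simp only [Int.fract, sub_smul, Int.cast_smul_eq_zsmul, Finset.sum_sub_distrib]
        abel
      rw [h1]
      refine (norm_add_le _ _).trans (add_le_add hzr ((norm_sum_le _ _).trans
        (Finset.sum_le_sum fun i _ ↦ ?_)))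
      rw [norm_smul, Real.norm_of_nonneg (Int.fract_nonneg _)]
      exact mul_le_of_le_one_left (norm_nonneg _) (Int.fract_lt_one _).le
    · rw [map_sub, (W.starProjection_orthogonal_eq_zero_iff _).2 hwW, sub_zero]
  obtain ⟨y', hy'L, hy', hy'r, hy'y⟩ := hshort y hyL hy le_rfl
  obtain ⟨x, ⟨⟨hxL, -⟩, hx⟩, hmin⟩ := Set.exists_min_image
    (((L : Set E) ∩ Metric.closedBall 0 (r + ∑ i, ‖v i‖)) ∩ {z | z ∉ W})
    (fun z ↦ ‖Wᗮ.starProjection z‖) ((finite_lattice_inter_closedBall L _).inter_of_left _)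
    ⟨y', ⟨hy'L, by simpa using hy'r⟩, hy'⟩
  have hxr : ‖Wᗮ.starProjection x‖ ≤ r := by
    have := hmin y' ⟨⟨hy'L, by simpa using hy'r⟩, hy'⟩
    rwa [hy'y] at this
  refine ⟨x, hxL, hx, fun z hzL hz ↦ ?_⟩
  rcases le_total ‖Wᗮ.starProjection z‖ r with h | h
  · obtain ⟨z', hz'L, hz', hz'r, hz'z⟩ := hshort z hzL hz h
    rw [← hz'z]
    exact hmin z' ⟨⟨hz'L, by simpa using hz'r⟩, hz'⟩
  · exact hxr.trans h

/-- Primitivity is preserved when a vector with shortest projection is adjoined: otherwise rounding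
the coefficient of `x` would leave a lattice vector with a nonzero projection at most half as
long. -/
theorem mem_span_int_insert_of_minimal_projection (L : Submodule ℤ E) {s : Set E} {x : E}
    (hxL : x ∈ L) (hx : x ∉ Submodule.span ℝ s)
    (hs : ∀ z ∈ L, z ∈ Submodule.span ℝ s → z ∈ Submodule.span ℤ s)
    (hmin : ∀ z ∈ L, z ∉ Submodule.span ℝ s →
        ‖(Submodule.span ℝ s)ᗮ.starProjection x‖ ≤ ‖(Submodule.span ℝ s)ᗮ.starProjection z‖)
    {z : E} (hzL : z ∈ L) (hz : z ∈ Submodule.span ℝ (insert x s)) :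
    z ∈ Submodule.span ℤ (insert x s) := by
  obtain ⟨c, w, hw, rfl⟩ := Submodule.mem_span_insert.1 hz
  refine Submodule.mem_span_insert.2 ⟨round c, c • x + w - round c • x, hs _
    (sub_mem hzL (L.smul_mem _ hxL)) ?_, by abel⟩
  by_contra hcon
  have h1 := hmin _ (sub_mem hzL (L.smul_mem _ hxL)) hcon
  have h2 : (Submodule.span ℝ s)ᗮ.starProjection (c • x + w - round c • x) =
      (c - round c) • (Submodule.span ℝ s)ᗮ.starProjection x := by
    rw [← Int.cast_smul_eq_zsmul ℝ, map_sub, map_add, map_smul, map_smul,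
      (Submodule.starProjection_orthogonal_eq_zero_iff _ _).2 hw, add_zero, sub_smul]
  have h3 : 0 < ‖(Submodule.span ℝ s)ᗮ.starProjection x‖ :=
    norm_pos_iff.2 fun h ↦ hx ((Submodule.starProjection_orthogonal_eq_zero_iff _ _).1 h)
  rw [h2, norm_smul, Real.norm_eq_abs] at h1
  have := abs_sub_round c
  nlinarith

/-- The first `k` vectors of a Hermite–Korkine–Zolotarev basis. Each vector has the shortest nonzero
projection orthogonal to its predecessors, and the family is primitive in `L`. -/
theorem exists_hkz_family (L : Submodule ℤ E) [DiscreteTopology L] [IsZLattice ℝ L] (k : ℕ)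
    (hk : k ≤ finrank ℝ E) :
    ∃ v : Fin k → E, (∀ i, v i ∈ L) ∧ LinearIndependent ℝ v ∧
      (∀ z ∈ L, z ∈ Submodule.span ℝ (Set.range v) → z ∈ Submodule.span ℤ (Set.range v)) ∧
      ∀ i, ∀ z ∈ L, z ∉ Submodule.span ℝ (v '' Set.Iio i) →
        ‖(Submodule.span ℝ (v '' Set.Iio i))ᗮ.starProjection (v i)‖ ≤
          ‖(Submodule.span ℝ (v '' Set.Iio i))ᗮ.starProjection z‖ := by
  induction k with
  | zero => exact ⟨Fin.elim0, fun i ↦ i.elim0, linearIndependent_empty_type, by simp,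
      fun i ↦ i.elim0⟩
  | succ k ih =>
    obtain ⟨v, hvL, hv, hprim, hmin⟩ := ih (by omega)
    obtain ⟨y, hyL, hy⟩ : ∃ y ∈ L, y ∉ Submodule.span ℝ (Set.range v) := by
      by_contra! hcon
      have h1 : (⊤ : Submodule ℝ E) ≤ Submodule.span ℝ (Set.range v) := by
        rw [← IsZLattice.span_top (K := ℝ) (L := L)]
        exact Submodule.span_le.2 hcon
      have h2 := finrank_range_le_card (R := ℝ) v
      rw [Set.finrank, top_le_iff.1 h1, finrank_top, Fintype.card_fin] at h2
      omega
    obtain ⟨x, hxL, hx, hxmin⟩ := exists_minimal_projection L hvL hyL hy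
    have hrange : Set.range (Fin.snoc v x : Fin (k + 1) → E) = insert x (Set.range v) := by
      rw [Fin.range_snoc]
    have himage : ∀ i : Fin k, (Fin.snoc v x : Fin (k + 1) → E) '' Set.Iio i.castSucc =
        v '' Set.Iio i := fun i ↦ by
      rw [← Fin.image_castSucc_Iio, Set.image_image]
      simp
    have hlast : (Fin.snoc v x : Fin (k + 1) → E) '' Set.Iio (Fin.last k) = Set.range v := by
      have : Set.Iio (Fin.last k) = Set.range Fin.castSucc := by
        ext i; simp [Fin.lt_def]
      rw [this, ← Set.range_comp]
      congr 1
      ext i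
      simp
    refine ⟨Fin.snoc v x, fun i ↦ ?_, hv.finSnoc hx, ?_, fun i ↦ ?_⟩
    · induction i using Fin.lastCases <;> simp [hxL, hvL]
    · rw [hrange]
      exact fun z ↦ mem_span_int_insert_of_minimal_projection L hxL hx hprim hxmin
    · induction i using Fin.lastCases with
      | last => rw [hlast, Fin.snoc_last]; exact hxmin
      | cast i => rw [himage, Fin.snoc_castSucc]; exact hmin i

end

/-! ### Hermite–Korkine–Zolotarev bases -/

section
variable {E : Type*} [NormedAddCommGroup E] [InnerProductSpace ℝ E] {n : ℕ}

/-- The basis `b` of the lattice `L` is Hermite–Korkine–Zolotarev reduced, without the condition of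
size reduction. The orthonormal basis `q` is its normalized Gram–Schmidt basis, so that
`inner ℝ (q i) (b i)` is the `i`-th Gram–Schmidt length and the sum in `minimal` is the squared
distance of `z` from the span of the `b j`, `j < i`. -/
structure IsHKZ (L : Submodule ℤ E) (b : Basis (Fin n) ℝ E) (q : OrthonormalBasis (Fin n) ℝ E) :
    Prop where
  span_eq : Submodule.span ℤ (Set.range b) = L
  triangular : ∀ ⦃i j⦄, i < j → inner ℝ (q j) (b i) = 0
  pos : ∀ i, 0 < inner ℝ (q i) (b i)
  minimal : ∀ i, ∀ z ∈ L, z ∉ Submodule.span ℝ (b '' Set.Iio i) →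
    inner ℝ (q i) (b i) ^ 2 ≤ ∑ m ∈ Finset.Ici i, inner ℝ (q m) z ^ 2

theorem OrthonormalBasis.norm_sq_starProjection_orthogonal [FiniteDimensional ℝ E]
    (q : OrthonormalBasis (Fin n) ℝ E) (i : Fin n) (z : E) :
    ‖(Submodule.span ℝ (q '' Set.Iio i))ᗮ.starProjection z‖ ^ 2 =
      ∑ m ∈ Finset.Ici i, inner ℝ (q m) z ^ 2 := by
  have h1 : ∀ m, inner ℝ (q m) ((Submodule.span ℝ (q '' Set.Iio i))ᗮ.starProjection z) ^ 2 =
      if i ≤ m then inner ℝ (q m) z ^ 2 else 0 := fun m ↦ by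
    rw [← Submodule.inner_starProjection_left_eq_right]
    split_ifs with h
    · congr 2
      rw [Submodule.starProjection_eq_self_iff, Submodule.mem_orthogonal]
      intro u hu
      induction hu using Submodule.span_induction with
      | mem x hx =>
        obtain ⟨l, hl, rfl⟩ := hx
        exact q.orthonormal.2 (ne_of_lt (lt_of_lt_of_le hl h))
      | zero => simp
      | add x y _ _ hx hy => rw [inner_add_left, hx, hy, add_zero]
      | smul a x _ hx => rw [inner_smul_left, hx, mul_zero]
    · rw [(Submodule.starProjection_orthogonal_eq_zero_iff _ _).2
        (Submodule.subset_span (Set.mem_image_of_mem q (Set.mem_Iio.2 (not_le.1 h)))),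
      inner_zero_left, zero_pow two_ne_zero]
  rw [← q.sum_sq_inner_right]
  simp only [h1]
  rw [← Finset.sum_filter]
  congr 1
  ext m
  simp

theorem inner_gramSchmidt_self (v : Fin n → E) (i : Fin n) :
    inner ℝ (InnerProductSpace.gramSchmidt ℝ v i) (v i) =
      ‖InnerProductSpace.gramSchmidt ℝ v i‖ ^ 2 := by
  have h := InnerProductSpace.gramSchmidt_def'' ℝ v i
  conv_lhs => rw [h]
  rw [inner_add_right, inner_sum, Finset.sum_eq_zero, add_zero, real_inner_self_eq_norm_sq]
  intro j hj
  rw [inner_smul_right, InnerProductSpace.gramSchmidt_orthogonal ℝ v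
    (Finset.mem_Iio.1 hj).ne', mul_zero]

theorem exists_isHKZ [FiniteDimensional ℝ E] (hn : finrank ℝ E = n) (L : Submodule ℤ E)
    [DiscreteTopology L] [IsZLattice ℝ L] :
    ∃ (b : Basis (Fin n) ℝ E) (q : OrthonormalBasis (Fin n) ℝ E), IsHKZ L b q := by
  obtain ⟨v, hvL, hv, hprim, hmin⟩ := exists_hkz_family L n hn.ge
  have hcard : finrank ℝ E = Fintype.card (Fin n) := by simpa using hn
  have hspan : Submodule.span ℝ (Set.range v) = ⊤ :=
    hv.span_eq_top_of_card_eq_finrank' hcard.symm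
  let q := InnerProductSpace.gramSchmidtOrthonormalBasis hcard v
  have hgs0 : ∀ i, InnerProductSpace.gramSchmidt ℝ v i ≠ 0 := fun i ↦
    InnerProductSpace.gramSchmidt_ne_zero i hv
  have hq : ∀ i, q i = InnerProductSpace.gramSchmidtNormed ℝ v i := fun i ↦
    InnerProductSpace.gramSchmidtOrthonormalBasis_apply hcard (by
      simp [InnerProductSpace.gramSchmidtNormed, hgs0 i])
  have hqs : ∀ i, Submodule.span ℝ (v '' Set.Iio i) = Submodule.span ℝ (q '' Set.Iio i) := by
    intro i
    rw [show (q : Fin n → E) = InnerProductSpace.gramSchmidtNormed ℝ v from funext hq,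
      InnerProductSpace.span_gramSchmidtNormed, InnerProductSpace.span_gramSchmidt_Iio]
  have htri : ∀ ⦃i j⦄, i < j → inner ℝ (q j) (v i) = 0 := fun i j hij ↦
    InnerProductSpace.gramSchmidtOrthonormalBasis_inv_triangular hcard v hij
  refine ⟨Basis.mk hv hspan.ge, q, ?_, ?_, ?_, ?_⟩ <;> rw [Basis.coe_mk]
  · refine le_antisymm (Submodule.span_le.2 (Set.range_subset_iff.2 hvL)) fun z hz ↦ ?_
    exact hprim z hz (hspan ▸ Submodule.mem_top)
  · exact htri
  · intro i
    have := norm_pos_iff.2 (hgs0 i)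
    rw [hq, InnerProductSpace.gramSchmidtNormed, inner_smul_left, inner_gramSchmidt_self]
    simp only [RCLike.ofReal_real_eq_id, id, conj_trivial]
    positivity
  · intro i z hz hzi
    have h := hmin i z hz hzi
    rw [hqs i] at h
    have h2 := pow_le_pow_left₀ (norm_nonneg _) h 2
    rw [q.norm_sq_starProjection_orthogonal, q.norm_sq_starProjection_orthogonal] at h2
    refine le_trans ?_ h2
    exact Finset.single_le_sum (f := fun m ↦ inner ℝ (q m) (v i) ^ 2) (fun m _ ↦ sq_nonneg _)
      (Finset.mem_Ici.2 le_rfl)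

theorem Module.Basis.notMem_span_image_Iio (b : Basis (Fin n) ℝ E) {i l : Fin n} (hil : i ≤ l)
    {x : E} (hx : b.repr x l ≠ 0) : x ∉ Submodule.span ℝ (b '' Set.Iio i) := by
  rw [b.mem_span_image]
  intro h
  exact absurd (h (Finsupp.mem_support_iff.2 hx)) (not_lt.2 hil)

/-- The `j`-th Gram–Schmidt length against the determinant of the block `j, …, i` of the projected
lattice, by Minkowski's theorem on linear forms. The constant `k ^ k` for a block of size `k` is
larger than the best possible one. -/
theorem IsHKZ.pow_le_prod {L : Submodule ℤ E} {b : Basis (Fin n) ℝ E}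
    {q : OrthonormalBasis (Fin n) ℝ E} (h : IsHKZ L b q) {j i : Fin n} (hji : j ≤ i) :
    inner ℝ (q j) (b j) ^ (Finset.Icc j i).card ≤
      ((Finset.Icc j i).card : ℝ) ^ (Finset.Icc j i).card *
        ∏ m ∈ Finset.Icc j i, inner ℝ (q m) (b m) := by
  set s := Finset.Icc j i with hs
  have hjs : j ∈ s := Finset.left_mem_Icc.2 hji
  have : Nonempty s := ⟨⟨j, hjs⟩⟩
  have hk : s.card ≠ 0 := Finset.card_ne_zero_of_mem hjs
  have hk1 : (1 : ℝ) ≤ s.card := by exact_mod_cast Nat.one_le_iff_ne_zero.2 hk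
  set p := ∏ m ∈ s, inner ℝ (q m) (b m) with hp
  have hp0 : 0 < p := Finset.prod_pos fun m _ ↦ h.pos m
  let A : Matrix s s ℝ := Matrix.of fun m l ↦ inner ℝ (q m) (b l)
  have hdet : A.det = p := by
    have hA : A.IsUpperTriangular := fun m l hlm ↦ h.triangular hlm
    rw [Matrix.det_of_isUpperTriangular hA]
    simpa [A] using Finset.prod_coe_sort s fun m ↦ inner ℝ (q m) (b m)
  set t : ℝ := p ^ ((s.card : ℝ)⁻¹) with ht
  have ht0 : 0 ≤ t := by positivity
  have htk : t ^ s.card = p := Real.rpow_inv_natCast_pow hp0.le hk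
  obtain ⟨c, hc0, hc⟩ := A.exists_int_ne_zero_abs_mulVec_le (by rw [hdet]; exact hp0.ne') (t := t)
    (by rw [hdet, abs_of_pos hp0, Fintype.card_coe, htk]) ht0
  obtain ⟨l, hl⟩ := Function.ne_iff.1 hc0
  have hls := Finset.mem_Icc.1 l.2
  set x : E := ∑ l : s, c l • b l with hx
  have hxL : x ∈ L := sum_mem fun l _ ↦ L.smul_mem _ (h.span_eq ▸ Submodule.subset_span ⟨l, rfl⟩)
  have hxl : b.repr x l = c l := by
    simp [hx, map_sum, Finsupp.finsetSum_apply, ← Int.cast_smul_eq_zsmul ℝ, Finsupp.single_apply]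
  have hxj : x ∉ Submodule.span ℝ (b '' Set.Iio j) :=
    b.notMem_span_image_Iio hls.1 (by rw [hxl]; exact_mod_cast hl)
  have hinner : ∀ m, inner ℝ (q m) x = ∑ l : s, inner ℝ (q m) (b l) * c l := fun m ↦ by
    simp [hx, inner_sum, ← Int.cast_smul_eq_zsmul ℝ, inner_smul_right, mul_comm]
  have hsum : ∑ m ∈ Finset.Ici j, inner ℝ (q m) x ^ 2 ≤ s.card * t ^ 2 := by
    rw [← nsmul_eq_mul, ← Finset.sum_subset (s₁ := s)]
    · refine Finset.sum_le_card_nsmul _ _ _ fun m hm ↦ ?_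
      rw [hinner]
      exact sq_le_sq' (abs_le.1 (hc ⟨m, hm⟩)).1 (abs_le.1 (hc ⟨m, hm⟩)).2
    · intro m hm
      exact Finset.mem_Ici.2 (Finset.mem_Icc.1 hm).1
    · intro m hm hms
      rw [hinner, Finset.sum_eq_zero, zero_pow two_ne_zero]
      intro l _
      rw [h.triangular, zero_mul]
      have h1 := Finset.mem_Icc.1 l.2
      have h2 : ¬ m ≤ i := fun h2 ↦ hms (Finset.mem_Icc.2 ⟨Finset.mem_Ici.1 hm, h2⟩)
      exact lt_of_le_of_lt h1.2 (not_le.1 h2)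
  have hmain : inner ℝ (q j) (b j) ≤ s.card * t := by
    refine le_of_sq_le_sq ?_ (by positivity)
    refine ((h.minimal j x hxL hxj).trans hsum).trans ?_
    rw [mul_pow]
    gcongr
    nlinarith
  calc _ ≤ (s.card * t) ^ s.card := pow_le_pow_left₀ (h.pos j).le hmain _
    _ = _ := by rw [mul_pow, htk]

end

/-- If each term of a sequence exceeds the mean of the terms up to it by at most a logarithm, then
the sequence grows at most like `log² N`: the mean of the first `k` terms increases by at most
`log N / k` when one more term is added, and the harmonic series sums these increments. -/
theorem le_of_mul_le_mul_log_add_sum {N : ℕ} {x : ℕ → ℝ}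
    (h : ∀ k < N, (k + 1 : ℝ) * x k ≤ (k + 1) * Real.log (k + 1) + ∑ r ∈ Finset.range (k + 1), x r)
    {k : ℕ} (hk : k < N) : x k ≤ x 0 + Real.log N * (2 + Real.log N) := by
  set l := Real.log N with hl
  have hl0 : 0 ≤ l := Real.log_natCast_nonneg N
  have hlog : ∀ k < N, Real.log (k + 1) ≤ l := fun k hk ↦
    Real.log_le_log (by positivity) (by exact_mod_cast hk)
  have hsum : ∀ k < N, ∑ r ∈ Finset.range (k + 1), x r ≤ (k + 1) * (x 0 + l * harmonic k) := by
    intro k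
    induction k with
    | zero => simp
    | succ k ih =>
      intro hk
      have h1 := ih (by omega)
      have h2 := h (k + 1) hk
      have h3 := hlog (k + 1) hk
      rw [Finset.sum_range_succ] at h2 ⊢
      set S := ∑ r ∈ Finset.range (k + 1), x r
      rw [harmonic_succ]
      push_cast at h2 h3 ⊢
      have hk0 : (0 : ℝ) < k + 1 := by positivity
      have h4 : (k + 1 : ℝ) * x (k + 1) ≤ (k + 2) * l + S := by nlinarith
      refine le_of_mul_le_mul_left ?_ hk0
      have h5 : (k + 1 : ℝ) * ((k + 1 + 1) * (x 0 + l * (harmonic k + (k + 1 : ℝ)⁻¹))) =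
          (k + 2) * ((k + 1) * (x 0 + l * harmonic k) + l) := by
        field_simp
        ring
      rw [h5]
      nlinarith
  have h1 := hsum k hk
  have h2 := h k hk
  have h3 := hlog k hk
  have h4 : (harmonic k : ℝ) ≤ 1 + l := by
    refine (harmonic_le_one_add_log k).trans (add_le_add le_rfl ?_)
    rcases Nat.eq_zero_or_pos k with rfl | hk0
    · simpa using hl0
    · exact Real.log_le_log (by positivity) (by exact_mod_cast hk.le)
  have hk0 : (0 : ℝ) < k + 1 := by positivity
  have h5 : x k ≤ l + (x 0 + l * harmonic k) := by
    refine le_of_mul_le_mul_left ?_ hk0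
    nlinarith
  nlinarith

/-! ### Bases adapted to the successive minima -/

section
variable {E : Type*} [NormedAddCommGroup E] [InnerProductSpace ℝ E] {n : ℕ}

/-- In a Hermite–Korkine–Zolotarev basis the Gram–Schmidt lengths decrease at most by a
quasi-polynomial factor. -/
theorem IsHKZ.inner_le_exp_mul {L : Submodule ℤ E} {b : Basis (Fin n) ℝ E}
    {q : OrthonormalBasis (Fin n) ℝ E} (h : IsHKZ L b q) {j i : Fin n} (hji : j ≤ i) :
    inner ℝ (q j) (b j) ≤
      Real.exp (Real.log n * (2 + Real.log n)) * inner ℝ (q i) (b i) := by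
  -- the sequence of Gram–Schmidt lengths is read backwards from the index `i`
  let r : ℕ → Fin n := fun k ↦ ⟨i - k, by omega⟩
  have key : ∀ k < i.1 + 1, (k + 1 : ℝ) * Real.log (inner ℝ (q (r k)) (b (r k))) ≤
      (k + 1) * Real.log (k + 1) +
        ∑ m ∈ Finset.range (k + 1), Real.log (inner ℝ (q (r m)) (b (r m))) := by
    intro k hk
    have h1 := h.pow_le_prod (j := r k) (i := i) (by simp [r, Fin.le_def])
    have hcard : (Finset.Icc (r k) i).card = k + 1 := by simp [r]; omega
    have hprod : ∑ m ∈ Finset.Icc (r k) i, Real.log (inner ℝ (q m) (b m)) =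
        ∑ m ∈ Finset.range (k + 1), Real.log (inner ℝ (q (r m)) (b (r m))) := by
      refine Finset.sum_nbij' (fun m ↦ i.1 - m.1) r ?_ ?_ ?_ ?_ ?_
      · intro m hm
        simp only [Finset.mem_Icc, Fin.le_def, r, Finset.mem_range] at hm ⊢
        omega
      · intro m hm
        simp only [Finset.mem_Icc, Fin.le_def, r, Finset.mem_range] at hm ⊢
        omega
      · intro m hm
        simp only [Finset.mem_Icc, Fin.le_def, r, Fin.ext_iff] at hm ⊢
        omega
      · intro m hm
        simp only [Finset.mem_range, r] at hm ⊢
        omega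
      · intro m hm
        have : r (i.1 - m.1) = m := by
          simp only [Finset.mem_Icc, Fin.le_def, r, Fin.ext_iff] at hm ⊢
          omega
        rw [this]
    rw [hcard] at h1
    have h2 := Real.log_le_log (pow_pos (h.pos _) _) h1
    have hp : ∏ m ∈ Finset.Icc (r k) i, inner ℝ (q m) (b m) ≠ 0 :=
      (Finset.prod_pos fun m _ ↦ h.pos m).ne'
    rw [Real.log_mul (by positivity) hp, Real.log_pow, Real.log_pow,
      Real.log_prod fun m _ ↦ (h.pos m).ne', hprod] at h2
    exact_mod_cast h2
  have h1 := le_of_mul_le_mul_log_add_sum (x := fun k ↦ Real.log (inner ℝ (q (r k)) (b (r k))))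
    key (k := i.1 - j.1) (by omega)
  have hj : r (i.1 - j.1) = j := by
    simp only [Fin.le_def, r, Fin.ext_iff] at hji ⊢
    omega
  have hi : r 0 = i := by simp [r]
  simp only [hj, hi] at h1
  have hlog : Real.log ((i.1 + 1 : ℕ) : ℝ) ≤ Real.log n :=
    Real.log_le_log (by positivity) (by exact_mod_cast i.2)
  have hlog0 : 0 ≤ Real.log ((i.1 + 1 : ℕ) : ℝ) := Real.log_natCast_nonneg _
  rw [← Real.log_le_log_iff (h.pos j) (mul_pos (Real.exp_pos _) (h.pos i)),
    Real.log_mul (Real.exp_ne_zero _) (h.pos i).ne', Real.log_exp]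
  nlinarith

/-- The basis `b` of the lattice `L` is graded by the scales `a`, up to the factor `D`: the
basis vector `b i` has length at most `D * a i` and its coordinate functional has norm at most
`D / a i`, the scales are increasing up to the factor `D`, and `a i` bounds from below the
length of every lattice vector outside some subspace of dimension at most `i`. The scales are then
the successive minima of `L` up to a factor. The coordinate bound is written without division. -/
structure IsGraded (L : Submodule ℤ E) (b : Basis (Fin n) ℝ E) (a : Fin n → ℝ) (D : ℝ) :
    Prop where
  span_eq : Submodule.span ℤ (Set.range b) = L
  pos : ∀ i, 0 < a i
  notMem_le : ∀ i : Fin n, ∃ W : Submodule ℝ E, finrank ℝ W ≤ i ∧ ∀ z ∈ L, z ∉ W → a i ≤ ‖z‖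
  mono : ∀ ⦃j i⦄, j ≤ i → a j ≤ D * a i
  norm_le : ∀ i, ‖b i‖ ≤ D * a i
  repr_le : ∀ i x, a i * |b.repr x i| ≤ D * ‖x‖

theorem OrthonormalBasis.norm_le_sum_abs_inner (q : OrthonormalBasis (Fin n) ℝ E) (x : E) :
    ‖x‖ ≤ ∑ m, |inner ℝ (q m) x| := by
  conv_lhs => rw [← q.sum_repr' x]
  refine (norm_sum_le _ _).trans_eq ?_
  simp [norm_smul]

theorem Matrix.IsUnitriangular.isUnit_int {V : Matrix (Fin n) (Fin n) ℤ} (hV : V.IsUnitriangular) :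
    IsUnit V.det := by
  have : V.det = 1 := by
    rw [Matrix.det_of_isUpperTriangular hV.2, Finset.prod_congr rfl fun i _ ↦ hV.1 i]
    simp
  simp [this]

/-- Seysen's reduction of the Gram–Schmidt coefficients of a Hermite–Korkine–Zolotarev basis. Since
all matrices stay upper triangular, the vector `b i` only involves the Gram–Schmidt lengths up to
`i` and its coordinate functional only those from `i` on, and `IsHKZ.inner_le_exp_mul` compares
both with the `i`-th one. -/
theorem exists_isGraded [FiniteDimensional ℝ E] (hn : finrank ℝ E = n) (L : Submodule ℤ E)
    [DiscreteTopology L] [IsZLattice ℝ L] :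
    ∃ (b : Basis (Fin n) ℝ E) (a : Fin n → ℝ), IsGraded L b a
      (n * Real.exp (Real.log n * (2 + Real.log n)) * 2 ^ (Nat.clog 2 n) ^ 2) := by
  obtain ⟨b, q, h⟩ := exists_isHKZ hn L
  set K : ℝ := Real.exp (Real.log n * (2 + Real.log n)) with hK
  set S : ℝ := 2 ^ (Nat.clog 2 n) ^ 2 with hS
  set a : Fin n → ℝ := fun i ↦ inner ℝ (q i) (b i) with ha
  have hapos : ∀ i, 0 < a i := h.pos
  have hmono : ∀ ⦃j i⦄, j ≤ i → a j ≤ K * a i := fun j i hji ↦ h.inner_le_exp_mul hji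
  let U : Matrix (Fin n) (Fin n) ℝ := Matrix.of fun m l ↦ (a m)⁻¹ * inner ℝ (q m) (b l)
  have hU : U.IsUnitriangular := ⟨fun i ↦ inv_mul_cancel₀ (hapos i).ne', fun i j hij ↦ by
    simp [U, h.triangular (show j < i from hij)]⟩
  obtain ⟨V, P, Q, hV, hP, hQ, hUV, hPQ, hbP, hbQ⟩ :=
    exists_seysen_reduction (Nat.clog 2 n) n (Nat.le_pow_clog one_lt_two n) U hU
  have hQP : Q * P = 1 := mul_eq_one_comm.1 hPQ
  -- the reduced basis, with Gram–Schmidt coordinates `a m * P m i`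
  set b' : Fin n → E := fun i ↦ ∑ l, V l i • b l with hb'
  have hinner : ∀ m i, inner ℝ (q m) (b' i) = a m * P m i := fun m i ↦ by
    rw [← hUV, Matrix.mul_apply, Finset.mul_sum, hb', inner_sum]
    refine Finset.sum_congr rfl fun l _ ↦ ?_
    rw [← Int.cast_smul_eq_zsmul ℝ, inner_smul_right]
    have := (hapos m).ne'
    simp only [U, Matrix.of_apply, Matrix.map_apply]
    field_simp
  have hspan : Submodule.span ℤ (Set.range b') = L := by
    rw [← h.span_eq]
    refine le_antisymm (Submodule.span_le.2 (Set.range_subset_iff.2 fun i ↦ sum_mem fun l _ ↦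
      Submodule.smul_mem _ _ (Submodule.subset_span ⟨l, rfl⟩)))
      (Submodule.span_le.2 (Set.range_subset_iff.2 fun l ↦ ?_))
    have hl : b l = ∑ i, V⁻¹ i l • b' i := by
      simp only [hb', Finset.smul_sum, smul_smul]
      rw [Finset.sum_comm]
      simp only [← Finset.sum_smul]
      have : ∀ m, ∑ i, V⁻¹ i l * V m i = (1 : Matrix (Fin n) (Fin n) ℤ) m l := fun m ↦ by
        rw [← Matrix.mul_nonsing_inv V hV.isUnit_int, Matrix.mul_apply]
        exact Finset.sum_congr rfl fun i _ ↦ mul_comm _ _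
      simp [this, Matrix.one_apply]
    rw [hl]
    exact sum_mem fun i _ ↦ Submodule.smul_mem _ _ (Submodule.subset_span ⟨i, rfl⟩)
  have hspanR : ⊤ ≤ Submodule.span ℝ (Set.range b') := by
    rw [← IsZLattice.span_top (K := ℝ) (L := L), ← hspan]
    exact Submodule.span_le.2 (Submodule.span_subset_span ℤ ℝ _)
  have hli : LinearIndependent ℝ b' :=
    linearIndependent_of_top_le_span_of_card_eq_finrank hspanR (by simp [hn])
  let B := Basis.mk hli hspanR
  have hB : ∀ i, B i = b' i := fun i ↦ Basis.mk_apply _ _ i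
  have hrepr : ∀ i x, B.repr x i = ∑ m, Q i m * ((a m)⁻¹ * inner ℝ (q m) x) := fun i x ↦ by
    have h1 : ∀ m, (a m)⁻¹ * inner ℝ (q m) x = ∑ l, P m l * B.repr x l := fun m ↦ by
      conv_lhs => rw [← B.sum_repr x]
      rw [inner_sum, Finset.mul_sum]
      refine Finset.sum_congr rfl fun l _ ↦ ?_
      rw [inner_smul_right, hB, hinner]
      have := (hapos m).ne'
      field_simp
    have h2 : Q.mulVec (P.mulVec (B.repr x)) i = B.repr x i := by
      rw [Matrix.mulVec_mulVec, hQP, Matrix.one_mulVec]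
    rw [← h2]
    simp only [Matrix.mulVec, dotProduct, h1]
  have hS1 : 1 ≤ S := one_le_pow₀ (by norm_num)
  have hn1 : ∀ i : Fin n, (1 : ℝ) ≤ n := fun i ↦ by exact_mod_cast i.pos
  refine ⟨B, a, ?_, hapos, fun i ↦ ?_, fun j i hji ↦ ?_, fun i ↦ ?_, fun i x ↦ ?_⟩
  · rw [show (B : Fin n → E) = b' from funext hB, hspan]
  · refine ⟨Submodule.span ℝ (b '' Set.Iio i), ?_, fun z hz hzi ↦ ?_⟩
    · rw [Set.image_eq_range]
      exact (finrank_range_le_card _).trans_eq (by simp)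
    · refine le_of_sq_le_sq ?_ (norm_nonneg _)
      refine (h.minimal i z hz hzi).trans ?_
      rw [← q.sum_sq_inner_right]
      exact Finset.sum_le_univ_sum_of_nonneg fun m ↦ sq_nonneg _
  · refine (hmono hji).trans ?_
    have : K * 1 ≤ K * (n * S) := by
      gcongr
      nlinarith [hn1 i]
    nlinarith [hapos i]
  · rw [hB]
    refine (q.norm_le_sum_abs_inner _).trans ?_
    have : ∀ m ∈ Finset.univ, |inner ℝ (q m) (b' i)| ≤ K * a i * S := fun m _ ↦ by
      rw [hinner, abs_mul, abs_of_pos (hapos m)]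
      rcases le_or_gt m i with hmi | hmi
      · exact mul_le_mul (hmono hmi) (hbP m i) (abs_nonneg _)
          (mul_nonneg (Real.exp_pos _).le (hapos i).le)
      · rw [hP.2 hmi, abs_zero, mul_zero]
        have := hapos i
        positivity
    refine (Finset.sum_le_card_nsmul _ _ _ this).trans_eq ?_
    simp
    ring
  · have : ∀ m ∈ Finset.univ, |Q i m * ((a m)⁻¹ * inner ℝ (q m) x)| ≤ S * (K * (a i)⁻¹ * ‖x‖) := by
      intro m _
      rw [abs_mul, abs_mul, abs_of_pos (inv_pos.2 (hapos m))]
      rcases le_or_gt i m with hmi | hmi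
      · have h1 : (a m)⁻¹ ≤ K * (a i)⁻¹ := by
          rw [← div_eq_mul_inv, le_div_iff₀ (hapos i), inv_mul_le_iff₀ (hapos m), mul_comm]
          exact hmono hmi
        have h2 : |inner ℝ (q m) x| ≤ ‖x‖ := by
          simpa using abs_real_inner_le_norm (q m) x
        have := hapos i
        have := hapos m
        gcongr
        exact hbQ i m
      · rw [hQ.2 hmi, abs_zero, zero_mul]
        have := hapos i
        positivity
    rw [hrepr]
    have h3 := (Finset.abs_sum_le_sum_abs _ _).trans (Finset.sum_le_card_nsmul _ _ _ this)
    have h4 := mul_le_mul_of_nonneg_left h3 (hapos i).le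
    refine h4.trans_eq ?_
    have := (hapos i).ne'
    simp
    field_simp

end

/-! ### Successive minima and distortion -/

section
variable {n : ℕ} {L : Submodule ℤ (EuclideanSpace ℝ (Fin n))}

theorem IsGraded.one_le {b : Basis (Fin n) ℝ (EuclideanSpace ℝ (Fin n))} {a : Fin n → ℝ} {D : ℝ}
    (h : IsGraded L b a D) (i : Fin n) : 1 ≤ D := by
  have h1 := h.mono (le_refl i)
  have h2 := h.pos i
  by_contra hD
  nlinarith

theorem successiveMin_bddBelow (L : Submodule ℤ (EuclideanSpace ℝ (Fin n))) (i : ℕ) :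
    BddBelow {r : ℝ | 0 < r ∧ i ≤ finrank ℝ (Submodule.span ℝ
      ((L : Set (EuclideanSpace ℝ (Fin n))) ∩ Metric.closedBall 0 r))} :=
  ⟨0, fun _ hr ↦ hr.1.le⟩

theorem IsGraded.le_finrank {b : Basis (Fin n) ℝ (EuclideanSpace ℝ (Fin n))} {a : Fin n → ℝ} {D : ℝ}
    (h : IsGraded L b a D) (i : Fin n) :
    (i : ℕ) + 1 ≤ finrank ℝ (Submodule.span ℝ
      ((L : Set (EuclideanSpace ℝ (Fin n))) ∩ Metric.closedBall 0 (D ^ 2 * a i))) := by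
  have hD := h.one_le i
  have h1 : Submodule.span ℝ (Set.range fun j : Set.Iic i ↦ b j) ≤ Submodule.span ℝ
      ((L : Set (EuclideanSpace ℝ (Fin n))) ∩ Metric.closedBall 0 (D ^ 2 * a i)) := by
    refine Submodule.span_mono ?_
    rintro _ ⟨j, rfl⟩
    refine ⟨h.span_eq ▸ Submodule.subset_span ⟨j, rfl⟩, ?_⟩
    rw [mem_closedBall_zero_iff]
    refine (h.norm_le j).trans ?_
    rw [pow_two, mul_assoc]
    exact mul_le_mul_of_nonneg_left (h.mono j.2) (by linarith)
  refine le_trans (le_of_eq ?_) (Submodule.finrank_mono h1)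
  rw [finrank_span_eq_card (b := fun j : Set.Iic i ↦ b j)
    (b.linearIndependent.comp _ Subtype.val_injective)]
  simp

theorem IsGraded.successiveMin_le {b : Basis (Fin n) ℝ (EuclideanSpace ℝ (Fin n))} {a : Fin n → ℝ}
    {D : ℝ} (h : IsGraded L b a D) (i : Fin n) :
    successiveMin L ((i : ℕ) + 1) ≤ D ^ 2 * a i := by
  have := h.one_le i
  have := h.pos i
  exact csInf_le (successiveMin_bddBelow L _) ⟨by positivity, h.le_finrank i⟩

theorem IsGraded.le_successiveMin {b : Basis (Fin n) ℝ (EuclideanSpace ℝ (Fin n))} {a : Fin n → ℝ}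
    {D : ℝ} (h : IsGraded L b a D) (i : Fin n) :
    a i ≤ successiveMin L ((i : ℕ) + 1) := by
  have := h.one_le i
  have := h.pos i
  refine le_csInf ⟨_, by positivity, h.le_finrank i⟩ ?_
  rintro r ⟨-, hr⟩
  obtain ⟨W, hW, hle⟩ := h.notMem_le i
  obtain ⟨z, ⟨hzL, hzr⟩, hzW⟩ : ∃ z ∈ (L : Set (EuclideanSpace ℝ (Fin n))) ∩ Metric.closedBall 0 r,
      z ∉ W := by
    by_contra! hcon
    have := Submodule.finrank_mono (Submodule.span_le.2 hcon)
    omega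
  exact (hle z hzL hzW).trans (mem_closedBall_zero_iff.1 hzr)

theorem exists_isGraded_euclidean (L : Submodule ℤ (EuclideanSpace ℝ (Fin n)))
    [DiscreteTopology L] [IsZLattice ℝ L] :
    ∃ (b : Basis (Fin n) ℝ (EuclideanSpace ℝ (Fin n))) (a : Fin n → ℝ), IsGraded L b a
      (n * Real.exp (Real.log n * (2 + Real.log n)) * 2 ^ (Nat.clog 2 n) ^ 2) :=
  exists_isGraded (by simp) L

theorem successiveMin_pos (L : Submodule ℤ (EuclideanSpace ℝ (Fin n)))
    [DiscreteTopology L] [IsZLattice ℝ L] (i : Fin n) : 0 < successiveMin L ((i : ℕ) + 1) := by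
  obtain ⟨b, a, h⟩ := exists_isGraded_euclidean L
  exact (h.pos i).trans_le (h.le_successiveMin i)

theorem successiveMin_image_le {L₁ L₂ : Submodule ℤ (EuclideanSpace ℝ (Fin n))}
    [DiscreteTopology L₁] [IsZLattice ℝ L₁]
    (T : EuclideanSpace ℝ (Fin n) ≃L[ℝ] EuclideanSpace ℝ (Fin n))
    (hT : T '' (L₁ : Set (EuclideanSpace ℝ (Fin n))) = L₂) (i : Fin n) :
    successiveMin L₂ ((i : ℕ) + 1) ≤
      ‖(T : EuclideanSpace ℝ (Fin n) →L[ℝ] EuclideanSpace ℝ (Fin n))‖ *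
        successiveMin L₁ ((i : ℕ) + 1) := by
  have : Nonempty (Fin n) := ⟨i⟩
  have hT0 : 0 < ‖(T : EuclideanSpace ℝ (Fin n) →L[ℝ] EuclideanSpace ℝ (Fin n))‖ := T.norm_pos
  rw [← div_le_iff₀' hT0]
  obtain ⟨b, a, h⟩ := exists_isGraded_euclidean L₁
  have := h.one_le i
  have := h.pos i
  refine le_csInf ⟨_, by positivity, h.le_finrank i⟩ ?_
  rintro r ⟨hr0, hr⟩
  rw [div_le_iff₀' hT0]
  refine csInf_le (successiveMin_bddBelow L₂ _) ⟨by positivity, hr.trans ?_⟩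
  rw [← LinearEquiv.finrank_map_eq T.toLinearEquiv, Submodule.map_span]
  refine Submodule.finrank_mono (Submodule.span_mono ?_)
  rintro _ ⟨z, ⟨hzL, hzr⟩, rfl⟩
  refine ⟨hT ▸ ⟨z, hzL, rfl⟩, ?_⟩
  rw [mem_closedBall_zero_iff] at hzr ⊢
  exact ((T : EuclideanSpace ℝ (Fin n) →L[ℝ] EuclideanSpace ℝ (Fin n)).le_opNorm z).trans
    (mul_le_mul_of_nonneg_left hzr hT0.le)

theorem minimaRatio_le_norm (hn : 1 ≤ n) {L₁ L₂ : Submodule ℤ (EuclideanSpace ℝ (Fin n))}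
    [DiscreteTopology L₁] [IsZLattice ℝ L₁]
    (T : EuclideanSpace ℝ (Fin n) ≃L[ℝ] EuclideanSpace ℝ (Fin n))
    (hT : T '' (L₁ : Set (EuclideanSpace ℝ (Fin n))) = L₂) :
    minimaRatio L₁ L₂ ≤ ‖(T : EuclideanSpace ℝ (Fin n) →L[ℝ] EuclideanSpace ℝ (Fin n))‖ := by
  have : Nonempty (Fin n) := ⟨⟨0, hn⟩⟩
  refine ciSup_le fun i ↦ ?_
  rw [div_le_iff₀ (successiveMin_pos L₁ i)]
  exact successiveMin_image_le T hT i

theorem successiveMin_nonneg (L : Submodule ℤ (EuclideanSpace ℝ (Fin n))) (i : ℕ) :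
    0 ≤ successiveMin L i :=
  Real.sInf_nonneg fun _ hr ↦ hr.1.le

theorem minimaRatio_nonneg (L₁ L₂ : Submodule ℤ (EuclideanSpace ℝ (Fin n))) :
    0 ≤ minimaRatio L₁ L₂ :=
  Real.iSup_nonneg fun _ ↦ div_nonneg (successiveMin_nonneg _ _) (successiveMin_nonneg _ _)

/-- The map matching two graded bases has norm at most a factor times `minimaRatio`, because both
scales agree with the successive minima. -/
theorem IsGraded.norm_equiv_le {L₁ L₂ : Submodule ℤ (EuclideanSpace ℝ (Fin n))}
    {b₁ b₂ : Basis (Fin n) ℝ (EuclideanSpace ℝ (Fin n))} {a₁ a₂ : Fin n → ℝ} {D : ℝ}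
    (h₁ : IsGraded L₁ b₁ a₁ D) (h₂ : IsGraded L₂ b₂ a₂ D) (hD : 0 ≤ D) :
    ‖((b₁.equiv b₂ (Equiv.refl _)).toContinuousLinearEquiv :
      EuclideanSpace ℝ (Fin n) →L[ℝ] EuclideanSpace ℝ (Fin n))‖ ≤
        n * D ^ 4 * minimaRatio L₁ L₂ := by
  have hM := minimaRatio_nonneg L₁ L₂
  refine ContinuousLinearMap.opNorm_le_bound _ (by positivity) fun x ↦ ?_
  have hx : ((b₁.equiv b₂ (Equiv.refl _)).toContinuousLinearEquiv :
      EuclideanSpace ℝ (Fin n) →L[ℝ] EuclideanSpace ℝ (Fin n)) x =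
        ∑ i, b₁.repr x i • b₂ i := by
    change b₁.equiv b₂ (Equiv.refl _) x = _
    conv_lhs => rw [← b₁.sum_repr x, map_sum]
    simp only [map_smul, Basis.equiv_apply, Equiv.refl_apply]
  rw [hx]
  have key : ∀ i ∈ Finset.univ, ‖b₁.repr x i • b₂ i‖ ≤ D ^ 4 * minimaRatio L₁ L₂ * ‖x‖ := by
    intro i _
    have ha₁ := h₁.pos i
    have ha₂ := h₂.pos i
    have hl₁ : 0 < successiveMin L₁ ((i : ℕ) + 1) := ha₁.trans_le (h₁.le_successiveMin i)
    have h3 : successiveMin L₂ ((i : ℕ) + 1) ≤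
        minimaRatio L₁ L₂ * successiveMin L₁ ((i : ℕ) + 1) := by
      rw [← div_le_iff₀ hl₁]
      exact le_ciSup (f := fun i : Fin n ↦
        successiveMin L₂ ((i : ℕ) + 1) / successiveMin L₁ ((i : ℕ) + 1))
        (Set.finite_range _).bddAbove i
    have h4 : a₂ i ≤ minimaRatio L₁ L₂ * (D ^ 2 * a₁ i) :=
      (h₂.le_successiveMin i).trans
        (h3.trans (mul_le_mul_of_nonneg_left (h₁.successiveMin_le i) hM))
    rw [norm_smul, Real.norm_eq_abs]
    refine le_of_mul_le_mul_left ?_ ha₁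
    calc a₁ i * (|b₁.repr x i| * ‖b₂ i‖) = a₁ i * |b₁.repr x i| * ‖b₂ i‖ := by ring
      _ ≤ D * ‖x‖ * (D * (minimaRatio L₁ L₂ * (D ^ 2 * a₁ i))) :=
        mul_le_mul (h₁.repr_le i x) ((h₂.norm_le i).trans (mul_le_mul_of_nonneg_left h4 hD))
          (norm_nonneg _) (by positivity)
      _ = _ := by ring
  refine (norm_sum_le _ _).trans ((Finset.sum_le_card_nsmul _ _ _ key).trans_eq ?_)
  simp
  ring

theorem image_equiv_eq_of_span_eq {L₁ L₂ : Submodule ℤ (EuclideanSpace ℝ (Fin n))}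
    {b₁ b₂ : Basis (Fin n) ℝ (EuclideanSpace ℝ (Fin n))}
    (h₁ : Submodule.span ℤ (Set.range b₁) = L₁) (h₂ : Submodule.span ℤ (Set.range b₂) = L₂) :
    (b₁.equiv b₂ (Equiv.refl _)).toContinuousLinearEquiv ''
      (L₁ : Set (EuclideanSpace ℝ (Fin n))) = L₂ := by
  have key : L₁.map ((b₁.equiv b₂ (Equiv.refl _)).toLinearMap.restrictScalars ℤ) = L₂ := by
    rw [← h₁, ← h₂, Submodule.map_span, ← Set.range_comp]
    congr 2
    ext1 i
    simp
  rw [← key]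
  rfl

theorem condNumber_equiv {b₁ b₂ : Basis (Fin n) ℝ (EuclideanSpace ℝ (Fin n))} :
    condNumber (b₁.equiv b₂ (Equiv.refl _)).toContinuousLinearEquiv =
      ‖((b₁.equiv b₂ (Equiv.refl _)).toContinuousLinearEquiv :
        EuclideanSpace ℝ (Fin n) →L[ℝ] EuclideanSpace ℝ (Fin n))‖ *
      ‖((b₂.equiv b₁ (Equiv.refl _)).toContinuousLinearEquiv :
        EuclideanSpace ℝ (Fin n) →L[ℝ] EuclideanSpace ℝ (Fin n))‖ := by
  have : (b₁.equiv b₂ (Equiv.refl _)).toContinuousLinearEquiv.symm =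
      (b₂.equiv b₁ (Equiv.refl _)).toContinuousLinearEquiv := by
    apply ContinuousLinearEquiv.toLinearEquiv_injective
    change (b₁.equiv b₂ (Equiv.refl _)).symm = _
    rw [Basis.equiv_symm]
    rfl
  rw [condNumber, this]

/-- The factor of `exists_isGraded` is quasi-polynomial in `n`, and equal to `1` for `n = 1`. -/
theorem seysen_factor_le (hn : 1 ≤ n) :
    (n : ℝ) * Real.exp (Real.log n * (2 + Real.log n)) * 2 ^ (Nat.clog 2 n) ^ 2 ≤
      Real.exp (12 * Real.log n ^ 2) := by
  rcases hn.eq_or_lt with rfl | hn2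
  · simp
  set l := Real.log n with hl
  have h2 : Real.log 2 ≤ l := Real.log_le_log (by norm_num) (by exact_mod_cast hn2)
  have hlog2 := Real.log_two_gt_d9
  have hclog : (Nat.clog 2 n : ℝ) * Real.log 2 ≤ 2 * l := by
    have h3 : 2 ^ (Nat.clog 2 n - 1) ≤ n :=
      (Nat.pow_pred_clog_lt_self one_lt_two hn2).le
    have h4 : Real.log (2 ^ (Nat.clog 2 n - 1)) ≤ l :=
      Real.log_le_log (by positivity) (by exact_mod_cast h3)
    have h5 : 1 ≤ Nat.clog 2 n := Nat.clog_pos one_lt_two hn2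
    rw [Real.log_pow, Nat.cast_sub h5] at h4
    push_cast at h4
    linarith
  have hS : (2 : ℝ) ^ (Nat.clog 2 n) ^ 2 ≤ Real.exp (6 * l ^ 2) := by
    rw [← Real.log_le_iff_le_exp (by positivity), Real.log_pow]
    push_cast
    have hc : (0 : ℝ) ≤ Nat.clog 2 n := by positivity
    have h6 := mul_le_mul hclog hclog (by positivity) (by linarith)
    have h7 : (Nat.clog 2 n : ℝ) ^ 2 * Real.log 2 * Real.log 2 ≤ 6 * l ^ 2 * Real.log 2 := by
      nlinarith [sq_nonneg l]
    exact le_of_mul_le_mul_right h7 (by linarith)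
  have hnl : (n : ℝ) = Real.exp l := (Real.exp_log (by positivity)).symm
  calc _ ≤ Real.exp l * Real.exp (l * (2 + l)) * Real.exp (6 * l ^ 2) := by
        rw [← hnl]; gcongr
    _ = Real.exp (l + l * (2 + l) + 6 * l ^ 2) := by rw [Real.exp_add, Real.exp_add]
    _ ≤ _ := Real.exp_le_exp.2 (by nlinarith)

end

theorem theorem1p1 :
    ∃ C : ℝ, 0 < C ∧ ∀ (n : ℕ), 1 ≤ n →
      ∀ (L₁ L₂ : Submodule ℤ (EuclideanSpace ℝ (Fin n)))
        [DiscreteTopology L₁] [IsZLattice ℝ L₁] [DiscreteTopology L₂] [IsZLattice ℝ L₂],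
        minimaRatio L₁ L₂ * minimaRatio L₂ L₁ ≤ latticeDist L₁ L₂ ∧
        latticeDist L₁ L₂ ≤
          (n : ℝ) ^ (C * Real.log (n : ℝ)) * (minimaRatio L₁ L₂ * minimaRatio L₂ L₁) := by
  -- both norms are at most `n * D ^ 4 ≤ D ^ 5` times a ratio of minima, where `D` is at most
  -- `exp (12 * log² n)`
  refine ⟨120, by norm_num, fun n hn L₁ L₂ _ _ _ _ ↦ ⟨?_, ?_⟩⟩
  · obtain ⟨⟨T, hT, hκ⟩, -⟩ := latticeDist_isLeast L₁ L₂
    rw [← hκ, condNumber]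
    refine mul_le_mul (minimaRatio_le_norm hn T hT) (minimaRatio_le_norm hn T.symm ?_)
      (minimaRatio_nonneg _ _) (norm_nonneg _)
    rw [← hT, ← Set.image_comp]
    simp
  · obtain ⟨b₁, a₁, h₁⟩ := exists_isGraded_euclidean L₁
    obtain ⟨b₂, a₂, h₂⟩ := exists_isGraded_euclidean L₂
    have hle := seysen_factor_le hn
    set D : ℝ := n * Real.exp (Real.log n * (2 + Real.log n)) * 2 ^ (Nat.clog 2 n) ^ 2 with hD
    have hD0 : 0 ≤ D := by positivity
    have hnD : (n : ℝ) ≤ D := by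
      rw [hD, mul_assoc]
      refine le_mul_of_one_le_right (by positivity) (one_le_mul_of_one_le_of_one_le ?_ ?_)
      · exact Real.one_le_exp (by have := Real.log_natCast_nonneg n; positivity)
      · exact one_le_pow₀ (by norm_num)
    have hM := minimaRatio_nonneg L₁ L₂
    have hM' := minimaRatio_nonneg L₂ L₁
    refine ((latticeDist_isLeast L₁ L₂).2
      ⟨_, image_equiv_eq_of_span_eq h₁.span_eq h₂.span_eq, rfl⟩).trans ?_
    rw [condNumber_equiv]
    calc _ ≤ (n * D ^ 4 * minimaRatio L₁ L₂) * (n * D ^ 4 * minimaRatio L₂ L₁) :=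
          mul_le_mul (h₁.norm_equiv_le h₂ hD0) (h₂.norm_equiv_le h₁ hD0) (norm_nonneg _)
            (by positivity)
      _ ≤ (D * D ^ 4 * minimaRatio L₁ L₂) * (D * D ^ 4 * minimaRatio L₂ L₁) := by gcongr
      _ = D ^ 10 * (minimaRatio L₁ L₂ * minimaRatio L₂ L₁) := by ring
      _ ≤ Real.exp (12 * Real.log n ^ 2) ^ 10 * (minimaRatio L₁ L₂ * minimaRatio L₂ L₁) := by
        gcongr
      _ = _ := by
        rw [← Real.exp_nat_mul, Real.rpow_def_of_pos (by exact_mod_cast hn)]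
        congr 2
        push_cast
        ring
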